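/- Let $p$ be a prime and let $\Delta_p$ be the compact additive group of $p$-adic integers with its Borel $\sigma$-algebra; write $x_0,x_1,\ldots\in\{0,\dots,p-1\}$ for the digits of $x=\sum_{j\ge0}x_jp^j\in\Delta_p$, and $\widehat\Delta_p$ for the group of continuous characters $\chi:\Delta_p\to\{z\in\mathbb C:|z|=1\}$. A (possibly infinite) Borel measure $\eta$ on $\Delta_p$ is a Lévy measure if $\eta(\{0\})=0$, $\eta(\Delta_p\setminus U)<\infty$ for every Borel neighbourhood $U$ of $0$, and $\int_{\Delta_p}(1-\operatorname{Re}\chi)\,d\eta<\infty$ for every $\chi\in\widehat\Delta_p$. Theorem (Poisson limit theorem on the $p$-adic integers). Let $\{X_{n,k}:n\in\mathbb N,\ 1\le k\le K_n\}$ be a rowwise independent array of random elements of $\Delta_p$, and let $\eta$ be a Lévy measure on $\Delta_p$ such that (i) $\displaystyle\max_{1\le k\le K_n}\mathrm P\big(((X_{n,k})_0,\dots,(X_{n,k})_d)\neq 0\big)\to0$ as $n\to\infty$, for every integer $d\ge0$; (ii) $\displaystyle\sum_{k=1}^{K_n}\mathrm P\big((X_{n,k})_0=\ell_0,\dots,(X_{n,k})_d=\ell_d\big)\to\eta\big(\{x\in\Delta_p:x_0=\ell_0,\dots,x_d=\ell_d\}\big)$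 as $n\to\infty$, for every integer $d\ge0$ and all $\ell_0,\dots,\ell_d\in\{0,\dots,p-1\}$ with $(\ell_0,\dots,\ell_d)\ne0$. Then the array is infinitesimal, i.e. $\max_{1\le k\le K_n}\mathrm P(X_{n,k}\in\Delta_p\setminus U)\to0$ for every Borel neighbourhood $U$ of $0$. Moreover, the generalized Poisson measure $\pi_{\eta,0}$, that is, the probability measure on $\Delta_p$ determined by $$\int_{\Delta_p}\chi\,d\pi_{\eta,0}=\exp\Big\{\int_{\Delta_p}(\chi(x)-1)\,d\eta(x)\Big\}\qquad\text{for all }\chi\in\widehat\Delta_p,$$ exists and is unique, and the row sums $\sum_{k=1}^{K_n}X_{n,k}$ converge in distribution to $\pi_{\eta,0}$ as $n\to\infty$. -/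

import Mathlib

open MeasureTheory ProbabilityTheory Filter Topology
open scoped ENNReal

noncomputable section

namespace PoissonLimit

/-! ### Locally compact abelian groups (written additively) -/

section General

variable (G : Type*) [AddCommGroup G] [TopologicalSpace G]

/-- The group of continuous characters `G → Circle` of an additively written topological group,
with the compact-open topology. -/
abbrev Dual := PontryaginDual (Multiplicative G)

variable {G}

/-- The value `χ(x)` of a character, as a complex number. -/
def charVal (χ : Dual G) (x : G) : ℂ := (χ (Multiplicative.ofAdd x) : ℂ)

variable (G) in
/-- A local inner product for `G`. -/
structure LocalInnerProduct [MeasurableSpace G] where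
  /-- the underlying function `G × Ĝ → ℝ` -/
  toFun : G → Dual G → ℝ
  continuous_toFun : Continuous (fun q : G × Dual G => toFun q.1 q.2)
  /-- near the identity, `χ(x) = exp(i g(x, χ))`, uniformly for `χ` in a compact set -/
  char_eq : ∀ C : Set (Dual G), IsCompact C → ∃ U ∈ 𝓝 (0 : G), MeasurableSet U ∧
    ∀ x ∈ U, ∀ χ ∈ C, charVal χ x = Complex.exp (Complex.I * (toFun x χ : ℂ))
  map_mul : ∀ (x : G) (χ₁ χ₂ : Dual G), toFun x (χ₁ * χ₂) = toFun x χ₁ + toFun x χ₂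
  map_neg : ∀ (x : G) (χ : Dual G), toFun (-x) χ = -toFun x χ
  bounded : ∀ C : Set (Dual G), IsCompact C → ∃ M : ℝ, ∀ x : G, ∀ χ ∈ C, |toFun x χ| ≤ M
  tendsto_zero : ∀ C : Set (Dual G), IsCompact C → ∀ ε : ℝ, 0 < ε →
    ∀ᶠ x in 𝓝 (0 : G), ∀ χ ∈ C, |toFun x χ| ≤ ε

/-- `η` is a Lévy measure on `G`. -/
structure IsLevyMeasure [MeasurableSpace G] (η : Measure G) : Prop where
  zero : η {0} = 0
  finite_compl : ∀ U ∈ 𝓝 (0 : G), MeasurableSet U → η Uᶜ < ∞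
  lintegral_lt : ∀ χ : Dual G, ∫⁻ x, ENNReal.ofReal (1 - (charVal χ x).re) ∂η < ∞

/-- The probability measure `π` is the generalized Poisson measure `π_{η, g}`: its Fourier
transform at `χ` is `exp (∫ (χ(x) - 1 - i g(x, χ)) dη(x))`. -/
def IsGeneralizedPoisson [MeasurableSpace G] (η : Measure G) (g : LocalInnerProduct G)
    (π : ProbabilityMeasure G) : Prop :=
  ∀ χ : Dual G,
    Integrable (fun x => charVal χ x - 1 - Complex.I * (g.toFun x χ : ℂ)) η ∧
    ∫ x, charVal χ x ∂(π : Measure G) =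
      Complex.exp (∫ x, (charVal χ x - 1 - Complex.I * (g.toFun x χ : ℂ)) ∂η)

/-- Infinitesimality of a triangular array whose `n`-th row has entries `X n k`, `k < K n`, defined
on the probability space `(Ω n, P n)`. A supremum over an empty row is `0`. -/
def IsInfinitesimal [MeasurableSpace G] {Ω : ℕ → Type*} [∀ n, MeasurableSpace (Ω n)]
    (P : ∀ n, Measure (Ω n)) {K : ℕ → ℕ} (X : ∀ n, Fin (K n) → Ω n → G) : Prop :=
  ∀ U ∈ 𝓝 (0 : G), MeasurableSet U →
    Tendsto (fun n => ⨆ k : Fin (K n), P n {ω | X n k ω ∈ Uᶜ}) atTop (𝓝 0)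

end General

/-! ### The group of `p`-adic integers -/

section Padic

variable {p : ℕ} [hp : Fact p.Prime]

lemma appr_div_lt (x : ℤ_[p]) (j : ℕ) : x.appr (j + 1) / p ^ j < p := by
  rw [Nat.div_lt_iff_lt_mul (pow_pos hp.out.pos j), ← pow_succ']
  exact x.appr_lt (j + 1)

/-- The `j`-th digit `x_j ∈ {0, …, p - 1}` of `x = ∑ x_j p ^ j`. Here `x.appr n` is the
representative of `x` modulo `p ^ n` in `{0, …, p ^ n - 1}`. -/
def digit (x : ℤ_[p]) (j : ℕ) : Fin p := ⟨x.appr (j + 1) / p ^ j, appr_div_lt x j⟩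

lemma appr_eq_sum_digit (x : ℤ_[p]) (n : ℕ) :
    x.appr n = ∑ j ∈ Finset.range n, (digit x j : ℕ) * p ^ j := by
  induction n with
  | zero => simpa using x.appr_lt 0
  | succ n ih =>
    rw [Finset.sum_range_succ, ← ih]
    have hmono := x.appr_mono (Nat.le_succ n)
    obtain ⟨c, hc⟩ := x.dvd_appr_sub_appr n (n + 1) (Nat.le_succ n)
    have h1 : x.appr (n + 1) = x.appr n + p ^ n * c := by
      simp only [Nat.succ_eq_add_one] at hmono
      omega
    have hd : (digit x n : ℕ) = c := by
      change x.appr (n + 1) / p ^ n = c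
      rw [h1, Nat.add_mul_div_left _ _ (pow_pos hp.out.pos n), Nat.div_eq_of_lt (x.appr_lt n),
        zero_add]
    rw [hd, h1, mul_comm]

/-- The digits of `x` are those of its `p`-adic expansion. -/
lemma tendsto_sum_digit (x : ℤ_[p]) :
    Tendsto (fun n => ∑ j ∈ Finset.range n, ((digit x j : ℕ) : ℤ_[p]) * (p : ℤ_[p]) ^ j)
      atTop (𝓝 x) := by
  have h : ∀ n, ∑ j ∈ Finset.range n, ((digit x j : ℕ) : ℤ_[p]) * (p : ℤ_[p]) ^ j
      = (x.appr n : ℤ_[p]) := by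
    intro n
    rw [appr_eq_sum_digit]
    push_cast
    rfl
  simp only [h]
  rw [tendsto_iff_norm_sub_tendsto_zero]
  have hlim : Tendsto (fun n : ℕ => ((p : ℝ)⁻¹) ^ n) atTop (𝓝 0) :=
    tendsto_pow_atTop_nhds_zero_of_lt_one (by positivity)
      (inv_lt_one_of_one_lt₀ (by exact_mod_cast hp.out.one_lt))
  refine squeeze_zero (fun _ => norm_nonneg _) (fun n => ?_) hlim
  rw [norm_sub_rev]
  have := (PadicInt.norm_le_pow_iff_mem_span_pow (x - (x.appr n : ℤ_[p])) n).2 (x.appr_spec n)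
  simpa [zpow_neg, inv_pow] using this

/-- Every character of `ℤ_p` is trivial near `0`. -/
lemma eventually_charVal_eq_one (χ : Dual ℤ_[p]) : ∀ᶠ x in 𝓝 (0 : ℤ_[p]), charVal χ x = 1 := by
  have hcont : Continuous (fun x : ℤ_[p] => χ (Multiplicative.ofAdd x)) :=
    (map_continuous χ).comp continuous_ofAdd
  have hopen : IsOpen ((fun x : ℤ_[p] => χ (Multiplicative.ofAdd x)) ⁻¹'
      Circle.centeredArc (Real.pi / 2)) := (Circle.isOpen_centeredArc _).preimage hcont
  have h0 : (0 : ℤ_[p]) ∈ (fun x : ℤ_[p] => χ (Multiplicative.ofAdd x)) ⁻¹'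
      Circle.centeredArc (Real.pi / 2) := by
    rw [Set.mem_preimage, ofAdd_zero, map_one,
      Circle.mem_centeredArc (by linarith [Real.pi_pos])]
    simp [Real.pi_pos]
  obtain ⟨r, hr, hball⟩ := Metric.isOpen_iff.1 hopen 0 h0
  filter_upwards [Metric.ball_mem_nhds (0 : ℤ_[p]) hr] with x hx
  have : χ (Multiplicative.ofAdd x) = 1 := by
    refine Circle.eq_one_of_forall_pow_mem_centeredArc_pi_div_two fun n _ => ?_
    rw [← map_pow, ← ofAdd_nsmul]
    refine hball ?_
    rw [mem_ball_zero_iff] at hx ⊢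
    rw [nsmul_eq_mul]
    refine lt_of_le_of_lt ?_ hx
    rw [norm_mul]
    exact mul_le_of_le_one_left (norm_nonneg _) (PadicInt.norm_le_one _)
  simp [charVal, this]

variable (p) in
/-- The local inner product `g = 0` for the group of `p`-adic integers. -/
def zeroLocalInnerProduct [MeasurableSpace ℤ_[p]] [BorelSpace ℤ_[p]] :
    LocalInnerProduct ℤ_[p] where
  toFun _ _ := 0
  continuous_toFun := continuous_const
  char_eq C hC := by
    have hfin : C.Finite := hC.finite_of_discrete
    have hev : ∀ᶠ x in 𝓝 (0 : ℤ_[p]), ∀ χ ∈ C, charVal χ x = 1 :=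
      (Set.Finite.eventually_all hfin).2 fun χ _ => eventually_charVal_eq_one χ
    obtain ⟨U, hU, hUo, h0⟩ := eventually_nhds_iff.1 hev
    exact ⟨U, hUo.mem_nhds h0, hUo.measurableSet, fun x hx χ hχ => by simpa using hU x hx χ hχ⟩
  map_mul _ _ _ := by simp
  map_neg _ _ := by simp
  bounded _ _ := ⟨0, by simp⟩
  tendsto_zero _ _ ε hε := by simp [hε.le]

end Padic

end PoissonLimit

end

/-!
A character of `ℤ_p` is trivial near `0`, hence is a function of finitely many digits. So `χ - 1`
and `|χ - 1|` are finite combinations of indicators of cylinders that do not contain `0`, and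
hypothesis (ii) gives the convergence of their integrals against the row intensities
`∑ₖ P(X_{n,k} ∈ ·)` to those against `η`. By infinitesimality the factors of
`E χ(S_n) = ∏ₖ (1 + E(χ(X_{n,k}) - 1))` are uniformly close to `1`, and expanding their logarithms
to first order gives `E χ(S_n) → exp ∫ (χ - 1) dη`. Since `ℤ_p` is compact, the laws of the row sums
`S_n` have a limit point; its Fourier transform is this limit, which determines it because the
characters separate points. It is therefore the only limit point, so the laws converge to it.
-/

namespace PoissonLimit

open scoped BoundedContinuousFunction

/-! ### Products of factors close to `1` -/

section ArrayLimits

variable {α : Type*} {l : Filter α} {κ : α → Type*} [∀ a, Fintype (κ a)]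

lemma tendsto_sum_norm_sq_zero {E : Type*} [SeminormedAddCommGroup E] {z : ∀ a, κ a → E}
    (hsmall : ∀ ε > 0, ∀ᶠ a in l, ∀ k, ‖z a k‖ ≤ ε)
    (hbdd : IsBoundedUnder (· ≤ ·) l fun a => ∑ k, ‖z a k‖) :
    Tendsto (fun a => ∑ k, ‖z a k‖ ^ 2) l (𝓝 0) := by
  obtain ⟨M, hM⟩ := hbdd.eventually_le
  refine Metric.tendsto_nhds.2 fun δ hδ => ?_
  have hε : 0 < δ / (|M| + 1) := by positivity
  filter_upwards [hM, hsmall _ hε] with a hMa hεa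
  rw [Real.dist_0_eq_abs, abs_of_nonneg (by positivity)]
  calc ∑ k, ‖z a k‖ ^ 2
      ≤ ∑ k, δ / (|M| + 1) * ‖z a k‖ := by
        gcongr with k
        rw [sq]
        gcongr
        exact hεa k
    _ = δ / (|M| + 1) * ∑ k, ‖z a k‖ := by rw [Finset.mul_sum]
    _ ≤ δ / (|M| + 1) * |M| := by
        gcongr
        exact hMa.trans (le_abs_self M)
    _ < δ / (|M| + 1) * (|M| + 1) := by
        gcongr
        exact lt_add_one _
    _ = δ := by field_simp

lemma norm_log_one_add_sub_self_le_sq {z : ℂ} (hz : ‖z‖ ≤ 1 / 2) :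
    ‖Complex.log (1 + z) - z‖ ≤ ‖z‖ ^ 2 := by
  have hinv : (1 - ‖z‖)⁻¹ ≤ 2 := by
    rw [inv_le_comm₀ (by linarith) two_pos]
    linarith
  calc ‖Complex.log (1 + z) - z‖
      ≤ ‖z‖ ^ 2 * (1 - ‖z‖)⁻¹ / 2 := Complex.norm_log_one_add_sub_self_le (by linarith)
    _ ≤ ‖z‖ ^ 2 * 2 / 2 := by gcongr
    _ = ‖z‖ ^ 2 := by ring

theorem tendsto_prod_one_add_exp {z : ∀ a, κ a → ℂ} {w : ℂ}
    (hsmall : ∀ ε > 0, ∀ᶠ a in l, ∀ k, ‖z a k‖ ≤ ε)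
    (hbdd : IsBoundedUnder (· ≤ ·) l fun a => ∑ k, ‖z a k‖)
    (hw : Tendsto (fun a => ∑ k, z a k) l (𝓝 w)) :
    Tendsto (fun a => ∏ k, (1 + z a k)) l (𝓝 (Complex.exp w)) := by
  have hhalf := hsmall (1 / 2) (by norm_num)
  have hdiff : Tendsto (fun a => ∑ k, (Complex.log (1 + z a k) - z a k)) l (𝓝 0) := by
    refine squeeze_zero_norm' ?_ (tendsto_sum_norm_sq_zero hsmall hbdd)
    filter_upwards [hhalf] with a ha
    exact norm_sum_le_of_le _ fun k _ => norm_log_one_add_sub_self_le_sq (ha k)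
  have hlog : Tendsto (fun a => ∑ k, Complex.log (1 + z a k)) l (𝓝 w) := by
    simpa only [Finset.sum_sub_distrib, sub_add_cancel, zero_add] using hdiff.add hw
  refine ((Complex.continuous_exp.tendsto w).comp hlog).congr' ?_
  filter_upwards [hhalf] with a ha
  have hne : ∀ k, 1 + z a k ≠ 0 := fun k h => by
    have := ha k
    rw [← neg_eq_of_add_eq_zero_right h, norm_neg, norm_one] at this
    norm_num at this
  rw [Function.comp_apply, Complex.exp_sum]
  exact Finset.prod_congr rfl fun k _ => Complex.exp_log (hne k)

end ArrayLimits

/-! ### Functions of a finite-valued map -/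

section FiniteValued

variable {X S E : Type*} [MeasurableSpace X] [MeasurableSpace S] [MeasurableSingletonClass S]
  [NormedAddCommGroup E] {f : X → S} {g : S → E}

lemma integrable_comp_of_finite [Finite S] {μ : Measure X} (hf : Measurable f)
    (hμ : ∀ s, g s ≠ 0 → μ (f ⁻¹' {s}) ≠ ∞) : Integrable (fun x => g (f x)) μ := by
  refine Integrable.comp_measurable (f := f) ?_ hf
  rw [← integrableOn_univ, ← Set.iUnion_of_singleton, integrableOn_finite_iUnion]
  intro s
  rw [integrableOn_singleton_iff (by simp), Measure.map_apply hf (measurableSet_singleton s)]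
  exact or_iff_not_imp_left.2 fun hs => (hμ s (enorm_ne_zero.1 hs)).lt_top

variable [NormedSpace ℝ E] [CompleteSpace E]

lemma integral_comp_eq_sum_measureReal [Fintype S] {μ : Measure X} (hf : Measurable f)
    (hμ : ∀ s, g s ≠ 0 → μ (f ⁻¹' {s}) ≠ ∞) :
    ∫ x, g (f x) ∂μ = ∑ s, μ.real (f ⁻¹' {s}) • g s := by
  have hg : AEStronglyMeasurable g (μ.map f) :=
    (StronglyMeasurable.of_discrete).aestronglyMeasurable
  rw [← integral_map (f := g) hf.aemeasurable hg, integral_fintype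
    ((integrable_map_measure hg hf.aemeasurable).2
      (integrable_comp_of_finite (g := g) hf hμ))]
  simp only [map_measureReal_apply hf (measurableSet_singleton _)]

theorem tendsto_integral_comp_of_tendsto_measure_preimage [Finite S] {α : Type*}
    {l : Filter α} {μ : α → Measure X} {η : Measure X} (hf : Measurable f)
    (hη : ∀ s, g s ≠ 0 → η (f ⁻¹' {s}) ≠ ∞)
    (hlim : ∀ s, g s ≠ 0 → Tendsto (fun a => μ a (f ⁻¹' {s})) l (𝓝 (η (f ⁻¹' {s})))) :
    Tendsto (fun a => ∫ x, g (f x) ∂μ a) l (𝓝 (∫ x, g (f x) ∂η)) := by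
  cases nonempty_fintype S
  have hfin : ∀ᶠ a in l, ∀ s, g s ≠ 0 → μ a (f ⁻¹' {s}) ≠ ∞ := by
    simp only [eventually_all]
    exact fun s hs => (hlim s hs).eventually_ne (hη s hs)
  have hsum : Tendsto (fun a => ∑ s, (μ a).real (f ⁻¹' {s}) • g s) l
      (𝓝 (∑ s, η.real (f ⁻¹' {s}) • g s)) := by
    refine tendsto_finsetSum _ fun s _ => ?_
    by_cases hs : g s = 0
    · simp only [hs, smul_zero, tendsto_const_nhds]
    · exact ((ENNReal.tendsto_toReal (hη s hs)).comp (hlim s hs)).smul_const _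
  rw [integral_comp_eq_sum_measureReal (g := g) hf hη]
  refine hsum.congr' ?_
  filter_upwards [hfin] with a ha using (integral_comp_eq_sum_measureReal (g := g) hf ha).symm

end FiniteValued

/-! ### Fourier transforms -/

section Fourier

variable {G : Type*} [AddCommGroup G] [TopologicalSpace G]

lemma charVal_zero (χ : Dual G) : charVal χ 0 = 1 := by simp [charVal]

lemma charVal_add (χ : Dual G) (x y : G) : charVal χ (x + y) = charVal χ x * charVal χ y := by
  simp [charVal]

lemma charVal_sum (χ : Dual G) {ι : Type*} (s : Finset ι) (x : ι → G) :
    charVal χ (∑ i ∈ s, x i) = ∏ i ∈ s, charVal χ (x i) := by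
  simp only [charVal, ofAdd_sum, map_prod]
  exact map_prod Circle.coeHom _ _

lemma norm_charVal (χ : Dual G) (x : G) : ‖charVal χ x‖ = 1 :=
  Circle.norm_coe (χ (Multiplicative.ofAdd x))

lemma norm_charVal_sub_one_le_two (χ : Dual G) (x : G) : ‖charVal χ x - 1‖ ≤ 2 := by
  refine (norm_sub_le _ _).trans ?_
  rw [norm_charVal, norm_one, one_add_one_eq_two]

lemma continuous_charVal (χ : Dual G) : Continuous (charVal χ) :=
  continuous_subtype_val.comp ((map_continuous χ).comp continuous_ofAdd)

/-- A character as a bounded continuous function; being multiplicative in the character, this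
identifies the dual group with a submonoid of the algebra `G →ᵇ ℂ`. -/
noncomputable def charBCF : Dual G →* (G →ᵇ ℂ) where
  toFun χ := BoundedContinuousFunction.ofNormedAddCommGroup (charVal χ) (continuous_charVal χ) 1
    fun x => (norm_charVal χ x).le
  map_one' := by ext; simp [charVal]
  map_mul' χ ψ := by ext; rfl

lemma star_charBCF (χ : Dual G) : star (charBCF χ) = charBCF χ⁻¹ := by
  ext x
  exact (Circle.coe_inv_eq_conj (χ (Multiplicative.ofAdd x))).symm

variable (G) in
/-- The algebra of trigonometric polynomials on `G`. -/
noncomputable def trigPoly : StarSubalgebra ℂ (G →ᵇ ℂ) :=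
  StarAlgebra.adjoin ℂ (Set.range charBCF)

lemma charBCF_mem_trigPoly (χ : Dual G) : charBCF χ ∈ trigPoly G :=
  StarAlgebra.subset_adjoin ℂ _ ⟨χ, rfl⟩

lemma trigPoly_eq_span :
    Subalgebra.toSubmodule (trigPoly G).toSubalgebra = Submodule.span ℂ (Set.range charBCF) := by
  have hstar : star (Set.range (charBCF (G := G))) ⊆ Set.range charBCF := by
    rintro f ⟨χ, hχ⟩
    exact ⟨χ⁻¹, by rw [← star_charBCF, hχ, star_star]⟩
  rw [trigPoly, StarAlgebra.adjoin_eq_span, Set.union_eq_self_of_subset_right hstar,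
    ← MonoidHom.coe_mrange, Submonoid.closure_eq]

variable [MeasurableSpace G]

/-- The Fourier transform of a measure on `G`, as a function on the dual group. -/
noncomputable def fourierTransform (μ : Measure G) (χ : Dual G) : ℂ := ∫ x, charVal χ x ∂μ

theorem ext_of_fourierTransform_eq [PolishSpace G] [BorelSpace G]
    (hsep : (Set.range (charVal (G := G))).SeparatesPoints)
    {μ ν : Measure G} [IsFiniteMeasure μ] [IsFiniteMeasure ν]
    (h : ∀ χ, fourierTransform μ χ = fourierTransform ν χ) : μ = ν := by
  refine ext_of_forall_mem_subalgebra_integral_eq_of_polish (𝕜 := ℂ) (A := trigPoly G) ?_ ?_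
  · intro x y hxy
    obtain ⟨_, ⟨χ, rfl⟩, hχ⟩ := hsep hxy
    exact ⟨charVal χ, ⟨_, ⟨charBCF χ, charBCF_mem_trigPoly χ, rfl⟩, rfl⟩, hχ⟩
  · intro f hf
    replace hf : f ∈ Submodule.span ℂ (Set.range charBCF) := trigPoly_eq_span.le hf
    induction hf using Submodule.span_induction with
    | mem f hf => obtain ⟨χ, rfl⟩ := hf; exact h χ
    | zero => simp
    | add f g _ _ hf hg =>
      simp only [BoundedContinuousFunction.coe_add, Pi.add_apply]
      rw [integral_add (f.integrable μ) (g.integrable μ),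
        integral_add (f.integrable ν) (g.integrable ν), hf, hg]
    | smul c f _ hf =>
      simp only [BoundedContinuousFunction.coe_smul, integral_smul, hf]

theorem IsGeneralizedPoisson.unique [PolishSpace G] [BorelSpace G]
    (hsep : (Set.range (charVal (G := G))).SeparatesPoints)
    {η : Measure G} {g : LocalInnerProduct G} {π ν : ProbabilityMeasure G}
    (hν : IsGeneralizedPoisson η g ν) (hπ : IsGeneralizedPoisson η g π) : ν = π :=
  Subtype.ext <| ext_of_fourierTransform_eq (μ := (ν : Measure G)) (ν := (π : Measure G)) hsep
    fun χ => (hν χ).2.trans (hπ χ).2.symm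

section OpensMeasurable

variable [OpensMeasurableSpace G]

lemma aestronglyMeasurable_charVal (χ : Dual G) (μ : Measure G) :
    AEStronglyMeasurable (charVal χ) μ :=
  (continuous_charVal χ).aestronglyMeasurable

lemma integrable_charVal (χ : Dual G) (μ : Measure G) [IsFiniteMeasure μ] :
    Integrable (charVal χ) μ :=
  (charBCF χ).integrable μ

lemma integrable_charVal_sub_one (χ : Dual G) (μ : Measure G) [IsFiniteMeasure μ] :
    Integrable (fun x => charVal χ x - 1) μ :=
  (integrable_charVal χ μ).sub (integrable_const 1)

lemma integral_charVal_sub_one (χ : Dual G) (μ : Measure G) [IsProbabilityMeasure μ] :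
    ∫ x, (charVal χ x - 1) ∂μ = fourierTransform μ χ - 1 := by
  rw [integral_sub (integrable_charVal χ μ) (integrable_const 1), integral_const, probReal_univ,
    one_smul, fourierTransform]

lemma continuous_fourierTransform (χ : Dual G) :
    Continuous fun μ : ProbabilityMeasure G => fourierTransform (μ : Measure G) χ :=
  continuous_iff_continuousAt.2 fun _ =>
    (ProbabilityMeasure.tendsto_iff_forall_integral_rclike_tendsto ℂ).1 tendsto_id (charBCF χ)

lemma norm_fourierTransform_sub_one_le (χ : Dual G) (μ : Measure G) [IsProbabilityMeasure μ]
    {U : Set G} (hU : MeasurableSet U) {δ : ℝ} (hδ : 0 ≤ δ)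
    (hχ : ∀ x ∈ U, ‖charVal χ x - 1‖ ≤ δ) :
    ‖fourierTransform μ χ - 1‖ ≤ δ + 2 * μ.real Uᶜ := by
  have hindicator : Integrable (Uᶜ.indicator fun _ => (2 : ℝ)) μ :=
    (integrable_const 2).indicator hU.compl
  have hpt : ∀ x, ‖charVal χ x - 1‖ ≤ δ + Uᶜ.indicator (fun _ => 2) x := fun x => by
    by_cases hx : x ∈ U
    · simpa [hx] using hχ x hx
    · simpa [hx] using (norm_charVal_sub_one_le_two χ x).trans (le_add_of_nonneg_left hδ)
  rw [← integral_charVal_sub_one]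
  calc ‖∫ x, (charVal χ x - 1) ∂μ‖
      ≤ ∫ x, (δ + Uᶜ.indicator (fun _ => 2) x) ∂μ :=
        norm_integral_le_of_norm_le ((integrable_const δ).add hindicator) (ae_of_all _ hpt)
    _ = δ + 2 * μ.real Uᶜ := by
        rw [integral_add (integrable_const δ) hindicator, integral_const,
          integral_indicator_const _ hU.compl, probReal_univ, one_smul, smul_eq_mul, mul_comm 2]

end OpensMeasurable

theorem exists_tendsto_of_tendsto_fourierTransform [CompactSpace G] [PolishSpace G] [BorelSpace G]
    (hsep : (Set.range (charVal (G := G))).SeparatesPoints)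
    {α : Type*} {l : Filter α} [l.NeBot] {μ : α → ProbabilityMeasure G} {φ : Dual G → ℂ}
    (h : ∀ χ, Tendsto (fun a => fourierTransform (μ a : Measure G) χ) l (𝓝 (φ χ))) :
    ∃ π : ProbabilityMeasure G, (∀ χ, fourierTransform (π : Measure G) χ = φ χ) ∧
      Tendsto μ l (𝓝 π) := by
  have hcluster : ∀ π, MapClusterPt π l μ → ∀ χ, fourierTransform (π : Measure G) χ = φ χ := by
    intro π hπ χ
    have hφ := hπ.continuousAt_comp (continuous_fourierTransform χ).continuousAt
    exact eq_of_nhds_neBot (ClusterPt.mono hφ (h χ))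
  obtain ⟨π, hπ⟩ := exists_clusterPt_of_compactSpace (map μ l)
  refine ⟨π, hcluster π hπ, tendsto_nhds_of_unique_mapClusterPt fun ν hν => Subtype.ext ?_⟩
  exact ext_of_fourierTransform_eq (μ := (ν : Measure G)) (ν := (π : Measure G)) hsep fun χ =>
    (hcluster ν hν χ).trans (hcluster π hπ χ).symm

end Fourier

/-! ### Row sums of infinitesimal arrays -/

section Arrays

variable {G : Type*} [AddCommGroup G] [TopologicalSpace G] [MeasurableSpace G]

section Row

variable {Ω ι : Type*} [MeasurableSpace Ω] [Fintype ι] {P : Measure Ω} {X : ι → Ω → G}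

/-- The intensity measure `∑ i, P ∘ (X i)⁻¹` of the point process formed by a finite family of
random elements: it turns sums of expectations over the family into a single integral. -/
noncomputable def intensity (P : Measure Ω) (X : ι → Ω → G) : Measure G := ∑ i, P.map (X i)

lemma fourierTransform_map_sum [OpensMeasurableSpace G] [MeasurableAdd₂ G]
    (hmeas : ∀ i, AEMeasurable (X i) P) (hindep : iIndepFun X P) (χ : Dual G) :
    fourierTransform (P.map fun ω => ∑ i, X i ω) χ = ∏ i, fourierTransform (P.map (X i)) χ := by
  have hsum : AEMeasurable (fun ω => ∑ i, X i ω) P :=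
    Finset.aemeasurable_fun_sum _ fun i _ => hmeas i
  simp only [fourierTransform, integral_map hsum (aestronglyMeasurable_charVal χ _),
    fun i => integral_map (hmeas i) (aestronglyMeasurable_charVal χ _), charVal_sum]
  exact hindep.integral_fun_prod_comp hmeas fun i => aestronglyMeasurable_charVal χ _

end Row

variable {Ω : ℕ → Type*} [∀ n, MeasurableSpace (Ω n)] {P : ∀ n, Measure (Ω n)}
  [∀ n, IsProbabilityMeasure (P n)] {K : ℕ → ℕ} {X : ∀ n, Fin (K n) → Ω n → G}
  [OpensMeasurableSpace G]

lemma IsInfinitesimal.eventually_norm_fourierTransform_sub_one_le (hX : IsInfinitesimal P X)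
    (hmeas : ∀ n k, AEMeasurable (X n k) (P n)) (χ : Dual G) {ε : ℝ} (hε : 0 < ε) :
    ∀ᶠ n in atTop, ∀ k, ‖fourierTransform ((P n).map (X n k)) χ - 1‖ ≤ ε := by
  set U : Set G := {x | ‖charVal χ x - 1‖ < ε / 2}
  have hUo : IsOpen U :=
    isOpen_lt ((continuous_charVal χ).sub continuous_const).norm continuous_const
  have hU0 : (0 : G) ∈ U := by simp [U, charVal_zero, hε]
  have hpos : 0 < ENNReal.ofReal (ε / 4) := ENNReal.ofReal_pos.2 (by positivity)
  filter_upwards [(hX U (hUo.mem_nhds hU0) hUo.measurableSet).eventually_le_const hpos] with n hn k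
  have := Measure.isProbabilityMeasure_map (hmeas n k)
  have hcompl : ((P n).map (X n k)).real Uᶜ ≤ ε / 4 := by
    refine ENNReal.toReal_le_of_le_ofReal (by positivity) ?_
    rw [Measure.map_apply_of_aemeasurable (hmeas n k) hUo.measurableSet.compl]
    exact (le_iSup (fun k => P n {ω | X n k ω ∈ Uᶜ}) k).trans hn
  calc ‖fourierTransform ((P n).map (X n k)) χ - 1‖
      ≤ ε / 2 + 2 * ((P n).map (X n k)).real Uᶜ :=
        norm_fourierTransform_sub_one_le χ _ hUo.measurableSet (by positivity)
          fun x hx => le_of_lt hx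
    _ ≤ ε := by linarith

theorem IsInfinitesimal.tendsto_fourierTransform_sum [MeasurableAdd₂ G]
    (hX : IsInfinitesimal P X) (hmeas : ∀ n k, AEMeasurable (X n k) (P n))
    (hindep : ∀ n, iIndepFun (X n) (P n)) (χ : Dual G) {w : ℂ}
    (hbdd : IsBoundedUnder (· ≤ ·) atTop
      fun n => ∫ x, ‖charVal χ x - 1‖ ∂intensity (P n) (X n))
    (hw : Tendsto (fun n => ∫ x, (charVal χ x - 1) ∂intensity (P n) (X n)) atTop (𝓝 w)) :
    Tendsto (fun n => fourierTransform ((P n).map fun ω => ∑ k, X n k ω) χ) atTop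
      (𝓝 (Complex.exp w)) := by
  have hprob : ∀ n k, IsProbabilityMeasure ((P n).map (X n k)) := fun n k =>
    Measure.isProbabilityMeasure_map (hmeas n k)
  have hχ : ∀ n k, Integrable (fun x => charVal χ x - 1) ((P n).map (X n k)) := fun n k =>
    integrable_charVal_sub_one χ _
  have hsum : ∀ n, ∫ x, (charVal χ x - 1) ∂intensity (P n) (X n)
      = ∑ k, (fourierTransform ((P n).map (X n k)) χ - 1) := fun n => by
    simp only [intensity, integral_finsetSum_measure fun k _ => hχ n k, integral_charVal_sub_one]
  have hnorm : ∀ n, ∑ k, ‖fourierTransform ((P n).map (X n k)) χ - 1‖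
      ≤ ∫ x, ‖charVal χ x - 1‖ ∂intensity (P n) (X n) := fun n => by
    simp only [intensity, integral_finsetSum_measure fun k _ => (hχ n k).norm,
      ← integral_charVal_sub_one]
    exact Finset.sum_le_sum fun k _ => norm_integral_le_integral_norm _
  refine (tendsto_prod_one_add_exp
    (fun ε hε => hX.eventually_norm_fourierTransform_sub_one_le hmeas χ hε)
    (hbdd.mono_le (Eventually.of_forall hnorm)) (hw.congr hsum)).congr fun n => ?_
  simp only [add_sub_cancel, fourierTransform_map_sum (hmeas n) (hindep n)]

end Arrays

/-! ### Digits and characters of `ℤ_[p]` -/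

section Digits

variable {p : ℕ} [hp : Fact p.Prime]

lemma toZModPow_eq_iff_norm_sub_le {x y : ℤ_[p]} {n : ℕ} :
    PadicInt.toZModPow n x = PadicInt.toZModPow n y ↔ ‖x - y‖ ≤ (p : ℝ) ^ (-n : ℤ) := by
  rw [PadicInt.norm_le_pow_iff_mem_span_pow, ← PadicInt.ker_toZModPow, RingHom.mem_ker, map_sub,
    sub_eq_zero]

lemma isLocallyConstant_toZModPow (n : ℕ) :
    IsLocallyConstant (PadicInt.toZModPow n : ℤ_[p] → ZMod (p ^ n)) := by
  refine (IsLocallyConstant.iff_eventually_eq _).2 fun x => ?_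
  have hpos : (0 : ℝ) < (p : ℝ) ^ (-n : ℤ) := zpow_pos (by exact_mod_cast hp.out.pos) _
  filter_upwards [Metric.closedBall_mem_nhds x hpos] with y hy
  exact toZModPow_eq_iff_norm_sub_le.2 (mem_closedBall_iff_norm.1 hy)

lemma toZModPow_eq_iff_appr_eq {x y : ℤ_[p]} {n : ℕ} :
    PadicInt.toZModPow n x = PadicInt.toZModPow n y ↔ x.appr n = y.appr n := by
  change ((x.appr n : ℕ) : ZMod (p ^ n)) = ((y.appr n : ℕ) : ZMod (p ^ n)) ↔ _
  rw [ZMod.natCast_eq_natCast_iff', Nat.mod_eq_of_lt (x.appr_lt n), Nat.mod_eq_of_lt (y.appr_lt n)]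

/-- The vector `(x_0, …, x_d)` of the first `d + 1` digits of `x`, so that the cylinders of the
theorem are the fibres of `digits d`. -/
noncomputable def digits (d : ℕ) (x : ℤ_[p]) : Fin (d + 1) → Fin p := fun j => digit x j

lemma digits_eq_iff_toZModPow_eq {x y : ℤ_[p]} {d : ℕ} :
    digits d x = digits d y ↔ PadicInt.toZModPow (d + 1) x = PadicInt.toZModPow (d + 1) y := by
  refine ⟨fun h => ?_, fun h => funext fun j => ?_⟩
  · rw [toZModPow_eq_iff_appr_eq, appr_eq_sum_digit, appr_eq_sum_digit]
    refine Finset.sum_congr rfl fun j hj => ?_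
    rw [show digit x j = digit y j from congrFun h ⟨j, Finset.mem_range.1 hj⟩]
  · have happr : x.appr (j + 1) = y.appr (j + 1) := by
      rw [← toZModPow_eq_iff_appr_eq, ← PadicInt.cast_toZModPow _ _ j.isLt, h,
        PadicInt.cast_toZModPow _ _ j.isLt]
    simp only [digits, digit, happr]

lemma digits_sub_eq_digits_zero {x y : ℤ_[p]} {d : ℕ} (h : digits d x = digits d y) :
    digits d (x - y) = digits d 0 := by
  rw [digits_eq_iff_toZModPow_eq] at h ⊢
  rw [map_sub, h, sub_self, map_zero]

lemma isLocallyConstant_digits (d : ℕ) : IsLocallyConstant (digits (p := p) d) :=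
  (IsLocallyConstant.iff_eventually_eq _).2 fun x =>
    ((isLocallyConstant_toZModPow (d + 1)).eventually_eq x).mono fun _ =>
      digits_eq_iff_toZModPow_eq.2

lemma digit_zero (j : ℕ) : (digit (0 : ℤ_[p]) j : ℕ) = 0 := by
  have happr : ((PadicInt.appr (0 : ℤ_[p]) (j + 1) : ℕ) : ZMod (p ^ (j + 1))) = 0 :=
    map_zero (PadicInt.toZModPow (j + 1))
  have hzero := Nat.eq_zero_of_dvd_of_lt ((ZMod.natCast_eq_zero_iff _ _).1 happr)
    (PadicInt.appr_lt _ _)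
  simp only [digit, hzero, Nat.zero_div]

lemma preimage_digits_singleton (d : ℕ) (l : Fin (d + 1) → Fin p) :
    digits d ⁻¹' {l} = {x | ∀ j : Fin (d + 1), digit x j = l j} :=
  Set.ext fun _ => funext_iff

lemma ne_digits_zero_iff {d : ℕ} {l : Fin (d + 1) → Fin p} :
    l ≠ digits d 0 ↔ ∃ j, (l j : ℕ) ≠ 0 := by
  simp only [ne_eq, funext_iff, Fin.ext_iff, digits, digit_zero, not_forall]

lemma digits_ne_digits_zero_iff {d : ℕ} {x : ℤ_[p]} :
    digits d x ≠ digits d 0 ↔ ∃ j ≤ d, (digit x j : ℕ) ≠ 0 := by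
  simp only [ne_digits_zero_iff, digits, Fin.exists_iff, Nat.lt_succ_iff, exists_prop]

lemma exists_digits_eq_zero_imp_mem {U : Set ℤ_[p]} (hU : U ∈ 𝓝 0) :
    ∃ d, ∀ x, digits d x = digits d 0 → x ∈ U := by
  obtain ⟨r, hr, hball⟩ := Metric.mem_nhds_iff.1 hU
  obtain ⟨d, hd⟩ := PadicInt.exists_pow_neg_lt p hr
  refine ⟨d, fun x hx => hball (mem_ball_iff_norm.2 ?_)⟩
  calc ‖x - 0‖
      ≤ (p : ℝ) ^ (-(d + 1 : ℕ) : ℤ) :=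
        toZModPow_eq_iff_norm_sub_le.1 (digits_eq_iff_toZModPow_eq.1 hx)
    _ ≤ (p : ℝ) ^ (-d : ℤ) :=
        zpow_le_zpow_right₀ (by exact_mod_cast hp.out.one_lt.le) (by push_cast; lia)
    _ < r := hd

lemma exists_charVal_factorsThrough_digits (χ : Dual ℤ_[p]) :
    ∃ d, (charVal χ).FactorsThrough (digits d) := by
  obtain ⟨d, hd⟩ := exists_digits_eq_zero_imp_mem (eventually_charVal_eq_one χ)
  refine ⟨d, fun x y hxy => ?_⟩
  have hsub : charVal χ (x - y) = 1 := hd _ (digits_sub_eq_digits_zero hxy)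
  rw [← sub_add_cancel x y, charVal_add, hsub, one_mul]

/-- The character `x ↦ exp (2πi (x mod p ^ n) / p ^ n)` of `ℤ_[p]`. -/
noncomputable def toZModPowChar (n : ℕ) : Dual ℤ_[p] :=
  haveI : NeZero (p ^ n) := ⟨pow_ne_zero _ hp.out.ne_zero⟩
  { toMonoidHom := (ZMod.toCircle (N := p ^ n)).toMonoidHom.comp
      (AddMonoidHom.toMultiplicative (PadicInt.toZModPow n).toAddMonoidHom)
    continuous_toFun := ((isLocallyConstant_toZModPow n).comp ZMod.toCircle).continuous }

lemma separatesPoints_charVal : (Set.range (charVal (G := ℤ_[p]))).SeparatesPoints := by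
  intro x y hxy
  obtain ⟨n, hn⟩ : ∃ n, PadicInt.toZModPow n x ≠ PadicInt.toZModPow n y := by
    by_contra! h
    exact hxy (PadicInt.ext_of_toZModPow.1 h)
  have : NeZero (p ^ n) := ⟨pow_ne_zero _ hp.out.ne_zero⟩
  exact ⟨_, ⟨toZModPowChar n, rfl⟩, fun h => hn (ZMod.injective_toCircle (Circle.coe_injective h))⟩

lemma isInfinitesimal_of_tendsto_iSup_digit_ne_zero [MeasurableSpace ℤ_[p]]
    {Ω : ℕ → Type*} [∀ n, MeasurableSpace (Ω n)] {P : ∀ n, Measure (Ω n)} {K : ℕ → ℕ}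
    {X : ∀ n, Fin (K n) → Ω n → ℤ_[p]}
    (hmax : ∀ d : ℕ,
      Tendsto (fun n => ⨆ k : Fin (K n), P n {ω | ∃ j ≤ d, (digit (X n k ω) j : ℕ) ≠ 0})
        atTop (𝓝 0)) : IsInfinitesimal P X := by
  intro U hU _
  obtain ⟨d, hd⟩ := exists_digits_eq_zero_imp_mem hU
  refine tendsto_of_tendsto_of_tendsto_of_le_of_le tendsto_const_nhds (hmax d)
    (fun _ => zero_le) fun n => iSup_mono fun k => measure_mono fun ω hω => ?_
  exact digits_ne_digits_zero_iff.1 fun h => hω (hd _ h)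

end Digits

/-! ### Convergence on cylinders of `ℤ_[p]` -/

section Cylinders

variable {p : ℕ} [hp : Fact p.Prime] [MeasurableSpace ℤ_[p]] [BorelSpace ℤ_[p]]

lemma measurable_digits (d : ℕ) : Measurable (digits (p := p) d) :=
  (isLocallyConstant_digits d).continuous.measurable

lemma intensity_setOf_digit_eq {Ω ι : Type*} [MeasurableSpace Ω] [Fintype ι] {P : Measure Ω}
    {X : ι → Ω → ℤ_[p]} (hmeas : ∀ i, AEMeasurable (X i) P) {d : ℕ} (l : Fin (d + 1) → Fin p) :
    intensity P X {x | ∀ j : Fin (d + 1), digit x j = l j}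
      = ∑ i, P {ω | ∀ j : Fin (d + 1), digit (X i ω) j = l j} := by
  have hcyl : MeasurableSet {x : ℤ_[p] | ∀ j : Fin (d + 1), digit x j = l j} := by
    rw [← preimage_digits_singleton]
    exact measurable_digits d (measurableSet_singleton l)
  rw [intensity, Measure.finsetSum_apply]
  exact Finset.sum_congr rfl fun i _ => Measure.map_apply_of_aemeasurable (hmeas i) hcyl

lemma IsLevyMeasure.measure_preimage_digits_ne_top {η : Measure ℤ_[p]} (hη : IsLevyMeasure η)
    {d : ℕ} {l : Fin (d + 1) → Fin p} (hl : l ≠ digits d 0) : η (digits d ⁻¹' {l}) ≠ ∞ := by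
  have hopen := (isLocallyConstant_digits (p := p) d).isOpen_fiber (digits d 0)
  refine ne_top_of_le_ne_top (hη.finite_compl _ (hopen.mem_nhds rfl) hopen.measurableSet).ne
    (measure_mono fun x hx hx0 => hl ?_)
  exact (Set.mem_singleton_iff.1 hx).symm.trans hx0

section LocallyConstant

variable {E : Type*} [NormedAddCommGroup E] {η : Measure ℤ_[p]} {h : ℤ_[p] → E} {d : ℕ}

lemma IsLevyMeasure.integrable_of_factorsThrough_digits (hη : IsLevyMeasure η)
    (hd : h.FactorsThrough (digits d)) (h0 : h 0 = 0) : Integrable h η := by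
  obtain ⟨g, rfl⟩ := (Function.factorsThrough_iff h).1 hd
  refine integrable_comp_of_finite (g := g) (measurable_digits d) fun l hl => ?_
  exact hη.measure_preimage_digits_ne_top fun hl0 => hl (hl0 ▸ h0)

lemma IsLevyMeasure.tendsto_integral_of_factorsThrough_digits [NormedSpace ℝ E] [CompleteSpace E]
    (hη : IsLevyMeasure η) (hd : h.FactorsThrough (digits d)) (h0 : h 0 = 0)
    {α : Type*} {F : Filter α} {μ : α → Measure ℤ_[p]}
    (hμ : ∀ l, l ≠ digits d 0 →
      Tendsto (fun a => μ a (digits d ⁻¹' {l})) F (𝓝 (η (digits d ⁻¹' {l})))) :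
    Tendsto (fun a => ∫ x, h x ∂μ a) F (𝓝 (∫ x, h x ∂η)) := by
  obtain ⟨g, rfl⟩ := (Function.factorsThrough_iff h).1 hd
  have hne : ∀ l, g l ≠ 0 → l ≠ digits d 0 := fun l hl hl0 => hl (hl0 ▸ h0)
  exact tendsto_integral_comp_of_tendsto_measure_preimage (g := g) (measurable_digits d)
    (fun l hl => hη.measure_preimage_digits_ne_top (hne l hl)) fun l hl => hμ l (hne l hl)

end LocallyConstant

lemma IsLevyMeasure.isGeneralizedPoisson_of_fourierTransform_eq {η : Measure ℤ_[p]}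
    (hη : IsLevyMeasure η) {π : ProbabilityMeasure ℤ_[p]}
    (hπ : ∀ χ, fourierTransform (π : Measure ℤ_[p]) χ
      = Complex.exp (∫ x, (charVal χ x - 1) ∂η)) :
    IsGeneralizedPoisson η (zeroLocalInnerProduct p) π := by
  intro χ
  obtain ⟨d, hd⟩ := exists_charVal_factorsThrough_digits χ
  simp only [zeroLocalInnerProduct, Complex.ofReal_zero, mul_zero, sub_zero]
  exact ⟨hη.integrable_of_factorsThrough_digits (hd.comp_left (· - 1)) (by simp [charVal_zero]),
    hπ χ⟩

theorem tendsto_fourierTransform_sum_of_tendsto_intensity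
    {Ω : ℕ → Type*} [∀ n, MeasurableSpace (Ω n)] {P : ∀ n, Measure (Ω n)}
    [∀ n, IsProbabilityMeasure (P n)] {K : ℕ → ℕ} {X : ∀ n, Fin (K n) → Ω n → ℤ_[p]}
    (hX : IsInfinitesimal P X) (hmeas : ∀ n k, AEMeasurable (X n k) (P n))
    (hindep : ∀ n, iIndepFun (X n) (P n)) {η : Measure ℤ_[p]} (hη : IsLevyMeasure η)
    (hlim : ∀ (d : ℕ) (l : Fin (d + 1) → Fin p), l ≠ digits d 0 →
      Tendsto (fun n => intensity (P n) (X n) (digits d ⁻¹' {l})) atTop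
        (𝓝 (η (digits d ⁻¹' {l}))))
    (χ : Dual ℤ_[p]) :
    Tendsto (fun n => fourierTransform ((P n).map fun ω => ∑ k, X n k ω) χ) atTop
      (𝓝 (Complex.exp (∫ x, (charVal χ x - 1) ∂η))) := by
  obtain ⟨d, hd⟩ := exists_charVal_factorsThrough_digits χ
  have hnorm : Tendsto (fun n => ∫ x, ‖charVal χ x - 1‖ ∂intensity (P n) (X n)) atTop
      (𝓝 (∫ x, ‖charVal χ x - 1‖ ∂η)) :=
    hη.tendsto_integral_of_factorsThrough_digits (hd.comp_left fun z => ‖z - 1‖)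
      (by simp [charVal_zero]) (hlim d)
  exact hX.tendsto_fourierTransform_sum hmeas hindep χ hnorm.isBoundedUnder_le
    (hη.tendsto_integral_of_factorsThrough_digits (hd.comp_left (· - 1)) (by simp [charVal_zero])
      (hlim d))

end Cylinders

end PoissonLimit

open PoissonLimit in
theorem mainTheorem9 (p : ℕ) [Fact p.Prime] [MeasurableSpace ℤ_[p]] [BorelSpace ℤ_[p]]
    (Ω : ℕ → Type*) [∀ n, MeasurableSpace (Ω n)] (P : ∀ n, Measure (Ω n))
    [∀ n, IsProbabilityMeasure (P n)]
    (K : ℕ → ℕ) (X : ∀ n, Fin (K n) → Ω n → ℤ_[p])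
    (hmeas : ∀ n k, Measurable (X n k))
    (hindep : ∀ n, iIndepFun (X n) (P n))
    (η : Measure ℤ_[p]) (hη : IsLevyMeasure η)
    (hmax : ∀ d : ℕ,
      Tendsto (fun n => ⨆ k : Fin (K n), P n {ω | ∃ j ≤ d, (digit (X n k ω) j : ℕ) ≠ 0})
        atTop (𝓝 0))
    (hsum : ∀ (d : ℕ) (l : Fin (d + 1) → Fin p), (∃ j, (l j : ℕ) ≠ 0) →
      Tendsto (fun n => ∑ k : Fin (K n), P n {ω | ∀ j : Fin (d + 1), digit (X n k ω) j = l j})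
        atTop (𝓝 (η {x | ∀ j : Fin (d + 1), digit x j = l j}))) :
    IsInfinitesimal P X ∧
    ∃ π : ProbabilityMeasure ℤ_[p],
      IsGeneralizedPoisson η (zeroLocalInnerProduct p) π ∧
      (∀ ν : ProbabilityMeasure ℤ_[p],
        IsGeneralizedPoisson η (zeroLocalInnerProduct p) ν → ν = π) ∧
      TendstoInDistribution (fun n ω => ∑ k : Fin (K n), X n k ω) atTop id P
        (π : Measure ℤ_[p]) := by
  have hX : ∀ n k, AEMeasurable (X n k) (P n) := fun n k => (hmeas n k).aemeasurable
  have hinf : IsInfinitesimal P X := isInfinitesimal_of_tendsto_iSup_digit_ne_zero hmax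
  have hlim : ∀ (d : ℕ) (l : Fin (d + 1) → Fin p), l ≠ digits d 0 →
      Tendsto (fun n => intensity (P n) (X n) (digits d ⁻¹' {l})) atTop
        (𝓝 (η (digits d ⁻¹' {l}))) := fun d l hl => by
    simpa only [preimage_digits_singleton, intensity_setOf_digit_eq (hX _)]
      using hsum d l (ne_digits_zero_iff.1 hl)
  have hS : ∀ n, AEMeasurable (fun ω => ∑ k, X n k ω) (P n) := fun n =>
    Finset.aemeasurable_fun_sum _ fun k _ => hX n k
  obtain ⟨π, hπ, hconv⟩ := exists_tendsto_of_tendsto_fourierTransform separatesPoints_charVal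
    (μ := fun n => ⟨(P n).map fun ω => ∑ k, X n k ω, Measure.isProbabilityMeasure_map (hS n)⟩)
    (tendsto_fourierTransform_sum_of_tendsto_intensity hinf hX hindep hη hlim)
  have hGP := hη.isGeneralizedPoisson_of_fourierTransform_eq hπ
  refine ⟨hinf, π, hGP, fun ν hν => hν.unique separatesPoints_charVal hGP, hS, aemeasurable_id, ?_⟩
  convert hconv using 2
  exact congrArg 𝓝 (Subtype.ext Measure.map_id)
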